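/- Let $S$ be a semigroup and let $\sigma : S \to S$ be an involutive morphism, i.e. $\sigma(\sigma(x)) = x$ for all $x \in S$, and either $\sigma(xy) = \sigma(x)\sigma(y)$ for all $x,y \in S$ or $\sigma(xy) = \sigma(y)\sigma(x)$ for all $x,y\in S$. Let $\mu = \sum_{i \in I} c_i \delta_{z_i}$ be a complex measure on $S$ that is a (finite) complex linear combination of Dirac measures, where each $z_i$ lies in the center of $S$. A function $\chi : S \to \mathbb{C}$ is multiplicative if $\chi(xy) = \chi(x)\chi(y)$ for all $x,y \in S$, and $f : S \to \mathbb{C}$ is central if $f(xy) = f(yx)$ for all $x,y\in S$. The non-zero central solutions $f : S \to \mathbb{C}$ of the integral Van Vleck functional equation $$\int_S f(x\sigma(y)t)\,d\mu(t) - \int_S f(xyt)\,d\mu(t) = 2 f(x) f(y), \qquad x,y \in S,$$ are exactly the functions of the form $$f = \frac{\chi - \chi\circ\sigma}{2} \int_S \chi(\sigma(t))\,d\mu(t),$$ where $\chi : S \to \mathbb{C}$ is a multiplicative function such that $\int_S \chi(t)\,d\mu(t) \neq 0$ and $\int_S \chi(\sigma(t))\,d\mu(t) = -\int_S \chi(t)\,d\mu(t)$.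 Furthermore, if $S$ is a topological semigroup and $\sigma$ is continuous, then for any $f$ and $\chi$ related in this way, $f$ is continuous if and only if $\chi$ is continuous. -/

import Mathlib

open MeasureTheory

noncomputable section

namespace VanVleck

/-- An involutive morphism of a semigroup: an involutive map that is an automorphism
or an anti-automorphism. -/
def IsInvolutiveMorphism {S : Type*} [Semigroup S] (σ : S → S) : Prop :=
  ((∀ x y, σ (x * y) = σ x * σ y) ∨ (∀ x y, σ (x * y) = σ y * σ x)) ∧
    ∀ x, σ (σ x) = x

/-- The complex measure `∑ i, c i • δ_(z i)`, a linear combination of Dirac measures. It is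
defined on all subsets, so that every function can be integrated. -/
def diracCombination {S ι : Type*} [Fintype ι] (c : ι → ℂ) (z : ι → S) : @ComplexMeasure S ⊤ :=
  letI : MeasurableSpace S := ⊤
  ∑ i, c i • VectorMeasure.dirac (z i) (1 : ℂ)

/-- The integral `∫ h(t) dμ(t)` of a complex function against a complex measure that is defined
on all subsets. -/
def integral {S : Type*} (μ : @ComplexMeasure S ⊤) (h : S → ℂ) : ℂ :=
  letI : MeasurableSpace S := ⊤
  VectorMeasure.integral μ h (ContinuousLinearMap.mul ℝ ℂ)

/-- The integral against a linear combination of Dirac measures is the expected finite sum. -/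
theorem integral_diracCombination {S ι : Type*} [Fintype ι] (c : ι → ℂ) (z : ι → S)
    (h : S → ℂ) : integral (diracCombination c z) h = ∑ i, c i * h (z i) := by
  let _ : MeasurableSpace S := ⊤
  have key : ∀ i, c i • VectorMeasure.dirac (z i) (1 : ℂ) = VectorMeasure.dirac (z i) (c i) := by
    intro i
    ext s hs
    by_cases hx : z i ∈ s <;> simp [hx]
  have hμ : diracCombination c z = ∑ i, VectorMeasure.dirac (z i) (c i) :=
    Finset.sum_congr rfl fun i _ => key i
  rw [hμ]
  unfold integral
  rw [VectorMeasure.integral_finsetSum_vectorMeasure]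
  · simp [mul_comm]
  · intro i _
    rw [VectorMeasure.Integrable, VectorMeasure.variation_dirac]
    exact (integrable_dirac (by simp)).smul_measure (by simp)

/-- The integral Van Vleck functional equation
`∫ f(x σ(y) t) dμ(t) - ∫ f(x y t) dμ(t) = 2 f(x) f(y)`. -/
def IsSolution {S : Type*} [Semigroup S] (σ : S → S) (μ : @ComplexMeasure S ⊤) (f : S → ℂ) :
    Prop :=
  ∀ x y, integral μ (fun t => f (x * σ y * t)) - integral μ (fun t => f (x * y * t))
    = 2 * f x * f y

/-- A function on a semigroup is central if `f(xy) = f(yx)` for all `x`, `y`. -/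
def IsCentralFunction {S : Type*} [Semigroup S] (f : S → ℂ) : Prop :=
  ∀ x y, f (x * y) = f (y * x)

/-- `f = ((χ - χ ∘ σ) / 2) ∫ χ(σ(t)) dμ(t)`, where the multiplicative function `χ` satisfies
`∫ χ dμ ≠ 0` and `∫ χ ∘ σ dμ = - ∫ χ dμ`. -/
def IsGivenBy {S : Type*} [Semigroup S] (σ : S → S) (μ : @ComplexMeasure S ⊤) (f : S → ℂ)
    (χ : S →ₙ* ℂ) : Prop :=
  integral μ (fun t => χ t) ≠ 0 ∧
    integral μ (fun t => χ (σ t)) = -integral μ (fun t => χ t) ∧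
    ∀ x, f x = (χ x - χ (σ x)) / 2 * integral μ (fun t => χ (σ t))

end VanVleck

end

namespace VanVleck

open Finset

variable {S : Type*} [Semigroup S] {σ : S → S} {ι : Type*} [Fintype ι] {c : ι → ℂ} {z : ι → S}
  {f : S → ℂ}

theorem IsInvolutiveMorphism.map_mul_of_mem_center (hσ : IsInvolutiveMorphism σ) (y : S) {s : S}
    (hs : s ∈ Set.center S) : σ (y * s) = σ y * σ s := by
  rcases hσ.1 with h | h
  · exact h y s
  · rw [← hs.comm y, h]

theorem IsInvolutiveMorphism.comp_map_mul (hσ : IsInvolutiveMorphism σ) (χ : S →ₙ* ℂ) (x y : S) :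
    χ (σ (x * y)) = χ (σ x) * χ (σ y) := by
  rcases hσ.1 with h | h
  · rw [h, map_mul]
  · rw [h, map_mul, mul_comm]

/-- The convolution integral `x ↦ ∑ i, c i * f (x * z i)`. -/
def shiftSum (c : ι → ℂ) (z : ι → S) (f : S → ℂ) (x : S) : ℂ :=
  ∑ i, c i * f (x * z i)

theorem isSolution_diracCombination_iff :
    IsSolution σ (diracCombination c z) f ↔
      ∀ x y, shiftSum c z f (x * σ y) - shiftSum c z f (x * y) = 2 * f x * f y := by
  simp only [IsSolution, integral_diracCombination, shiftSum]

theorem sum_mul_eq_of_forall {u v w : ι → ℂ} {a b : ℂ}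
    (h : ∀ i, u i - v i = a * w i * b) :
    ∑ i, c i * u i - ∑ i, c i * v i = a * (∑ i, c i * w i) * b := by
  rw [← sum_sub_distrib, mul_sum, sum_mul]
  refine sum_congr rfl fun i _ => ?_
  linear_combination c i * h i

section Solution

variable (hσ : IsInvolutiveMorphism σ) (hz : ∀ i, z i ∈ Set.center S)
  (hf : f ≠ 0) (hcen : IsCentralFunction f)
  (hsol : ∀ x y, shiftSum c z f (x * σ y) - shiftSum c z f (x * y) = 2 * f x * f y)

include hσ hf hsol in
theorem solution_comp_involution (y : S) : f (σ y) = -f y := by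
  obtain ⟨x, hx⟩ := Function.ne_iff.1 hf
  have h1 := hsol x (σ y)
  rw [hσ.2] at h1
  exact mul_left_cancel₀ (mul_ne_zero two_ne_zero hx) (by linear_combination -h1 - hsol x y)

include hz hcen in
theorem shiftSum_mul_comm (x y : S) : shiftSum c z f (x * y) = shiftSum c z f (y * x) := by
  refine sum_congr rfl fun i _ => ?_
  rw [mul_assoc, hcen, mul_assoc, (hz i).comm x, mul_assoc]

include hσ hz hcen hsol in
theorem shiftSum_involution_mul (x y : S) :
    shiftSum c z f (σ (x * y)) = shiftSum c z f (x * y) := by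
  have key : ∀ x y, shiftSum c z f (x * σ y) = shiftSum c z f (y * σ x) := fun x y => by
    linear_combination hsol x y - hsol y x + shiftSum_mul_comm (c := c) hz hcen x y
  have h := key x (σ y)
  rw [hσ.2] at h
  rcases hσ.1 with hm | hm
  · rw [hm, shiftSum_mul_comm hz hcen, h]
  · rw [hm, h]

include hσ hz hf hcen hsol in
theorem sum_involution_mul (x y : S) :
    ∑ i, c i * f (x * y * σ (z i)) = -shiftSum c z f (x * y) := by
  rw [← shiftSum_involution_mul hσ hz hcen hsol, shiftSum, ← sum_neg_distrib]
  refine sum_congr rfl fun i _ => ?_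
  have h : σ (σ (x * y) * z i) = x * y * σ (z i) := by
    rw [hσ.map_mul_of_mem_center _ (hz i), hσ.2]
  rw [← h, solution_comp_involution hσ hf hsol]
  ring

include hσ hz hf hcen hsol in
theorem sum_shiftSum_involution (x : S) :
    ∑ i, c i * shiftSum c z f (x * σ (z i)) = -shiftSum c z (shiftSum c z f) x := by
  have h : ∑ i, c i * shiftSum c z f (x * σ (z i)) =
      ∑ j, c j * ∑ i, c i * f (x * z j * σ (z i)) := by
    simp only [shiftSum, mul_sum]
    rw [sum_comm]
    refine sum_congr rfl fun j _ => sum_congr rfl fun i _ => ?_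
    rw [mul_assoc x, mul_assoc x, (hz j).comm (σ (z i))]
    ring
  rw [h, shiftSum, ← sum_neg_distrib]
  refine sum_congr rfl fun j _ => ?_
  rw [sum_involution_mul hσ hz hf hcen hsol]
  ring

include hσ hz hf hcen hsol in
theorem shiftSum_shiftSum (x : S) :
    shiftSum c z (shiftSum c z f) x = -(f x * ∑ i, c i * f (z i)) := by
  have h : ∑ i, c i * shiftSum c z f (x * σ (z i)) - ∑ i, c i * shiftSum c z f (x * z i) =
      2 * (∑ i, c i * f (z i)) * f x :=
    sum_mul_eq_of_forall fun i => by rw [hsol]; ring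
  rw [sum_shiftSum_involution hσ hz hf hcen hsol] at h
  rw [shiftSum] at h ⊢
  linear_combination -h / 2

include hσ hz hf hcen hsol in
theorem solution_mul_add (x y : S) :
    (∑ i, c i * f (z i)) * (f (x * y) + f (x * σ y)) = 2 * f x * shiftSum c z f y := by
  have h : ∑ i, c i * shiftSum c z f (x * σ y * σ (z i)) -
      ∑ i, c i * shiftSum c z f (x * y * z i) = 2 * shiftSum c z f y * f x :=
    sum_mul_eq_of_forall fun i => by
      have h' := hsol x (y * z i)
      rw [hσ.map_mul_of_mem_center _ (hz i), ← mul_assoc, ← mul_assoc] at h'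
      rw [h']; ring
  have h1 := shiftSum_shiftSum hσ hz hf hcen hsol (x * y)
  rw [sum_shiftSum_involution hσ hz hf hcen hsol,
    shiftSum_shiftSum hσ hz hf hcen hsol] at h
  rw [shiftSum] at h1
  linear_combination h + h1

include hσ hz hf hcen hsol in
theorem solution_mul_sub (x y : S) :
    (∑ i, c i * f (z i)) * (f (x * y) - f (x * σ y)) = 2 * shiftSum c z f x * f y := by
  have h : ∑ i, c i * shiftSum c z f (x * σ y * z i) -
      ∑ i, c i * shiftSum c z f (x * y * z i) = 2 * shiftSum c z f x * f y :=
    sum_mul_eq_of_forall fun i => by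
      rw [← hsol, mul_assoc x, mul_assoc x, mul_assoc x, mul_assoc x, (hz i).comm, (hz i).comm]
  have h1 := shiftSum_shiftSum hσ hz hf hcen hsol (x * y)
  have h2 := shiftSum_shiftSum hσ hz hf hcen hsol (x * σ y)
  rw [shiftSum] at h1 h2
  linear_combination h + h1 - h2

include hσ hz hf hcen hsol in
theorem sum_solution_ne_zero : ∑ i, c i * f (z i) ≠ 0 := by
  intro h0
  obtain ⟨x, hx⟩ := Function.ne_iff.1 hf
  have hE : ∀ y, shiftSum c z f y = 0 := fun y => by
    have h := solution_mul_add hσ hz hf hcen hsol x y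
    rw [h0, zero_mul] at h
    simpa [show f x ≠ 0 from hx] using h.symm
  have h := hsol x x
  simp only [hE, sub_zero] at h
  exact hx (by simpa using h.symm)

include hσ hz hf hcen hsol in
/-- The sine addition law. -/
theorem solution_mul (x y : S) :
    (∑ i, c i * f (z i)) * f (x * y) = f x * shiftSum c z f y + shiftSum c z f x * f y := by
  linear_combination (solution_mul_add hσ hz hf hcen hsol x y +
    solution_mul_sub hσ hz hf hcen hsol x y) / 2

include hσ hz hf hcen hsol in
theorem shiftSum_mul (x y : S) :
    (∑ i, c i * f (z i)) * shiftSum c z f (x * y) =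
      shiftSum c z f x * shiftSum c z f y - (∑ i, c i * f (z i)) * (f x * f y) := by
  have h : (∑ i, c i * f (z i)) * (shiftSum c z f (x * y) + shiftSum c z f (x * σ y)) =
      2 * shiftSum c z f x * shiftSum c z f y := by
    conv_lhs => rw [shiftSum, shiftSum, ← sum_add_distrib, mul_sum]
    conv_rhs => rw [shiftSum, mul_sum, sum_mul]
    refine sum_congr rfl fun i _ => ?_
    have h' := solution_mul_add hσ hz hf hcen hsol (x * z i) y
    rw [mul_assoc x, mul_assoc x, (hz i).comm, (hz i).comm, ← mul_assoc, ← mul_assoc] at h'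
    linear_combination c i * h'
  linear_combination h / 2 - (∑ i, c i * f (z i)) / 2 * hsol x y

include hσ hz hf hcen hsol in
theorem shiftSum_involution (y : S) : shiftSum c z f (σ y) = shiftSum c z f y := by
  obtain ⟨x, hx⟩ := Function.ne_iff.1 hf
  have h1 := solution_mul_add hσ hz hf hcen hsol x (σ y)
  rw [hσ.2] at h1
  exact mul_left_cancel₀ (mul_ne_zero two_ne_zero hx)
    (by linear_combination solution_mul_add hσ hz hf hcen hsol x y - h1)

include hσ hz hf hcen hsol in
theorem sum_shiftSum_eq_zero : ∑ i, c i * shiftSum c z f (z i) = 0 := by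
  obtain ⟨x, hx⟩ := Function.ne_iff.1 hf
  have h : (∑ i, c i * f (z i)) * shiftSum c z f x =
      f x * ∑ i, c i * shiftSum c z f (z i) + shiftSum c z f x * ∑ i, c i * f (z i) := by
    conv_lhs => rw [shiftSum, mul_sum]
    rw [mul_sum, mul_sum, ← sum_add_distrib]
    refine sum_congr rfl fun i _ => ?_
    linear_combination c i * solution_mul hσ hz hf hcen hsol x (z i)
  exact (mul_eq_zero.1 (by linear_combination -h :
    f x * ∑ i, c i * shiftSum c z f (z i) = 0)).resolve_left hx

include hσ hz hf hcen hsol in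
theorem exists_isGivenBy : ∃ χ : S →ₙ* ℂ, IsGivenBy σ (diracCombination c z) f χ := by
  set α := ∑ i, c i * f (z i) with hα
  have hα0 : α ≠ 0 := sum_solution_ne_zero hσ hz hf hcen hsol
  obtain ⟨β, hβ⟩ := IsAlgClosed.exists_eq_mul_self (-α⁻¹)
  have hβα : β * β * α = -1 := by rw [← hβ]; field_simp
  have hβ0 : β ≠ 0 := by rintro rfl; simp at hβα
  let χ : S →ₙ* ℂ :=
    { toFun := fun x => shiftSum c z f x / α + β * f x
      map_mul' := fun x y => by
        have h1 := solution_mul hσ hz hf hcen hsol x y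
        have h2 := shiftSum_mul hσ hz hf hcen hsol x y
        rw [← hα] at h1 h2
        field_simp
        linear_combination h2 + β * α * h1 - α * f x * f y * hβα }
  have hχ : ∀ x, χ x = shiftSum c z f x / α + β * f x := fun _ => rfl
  have hχσ : ∀ x, χ (σ x) = shiftSum c z f x / α - β * f x := fun x => by
    rw [hχ, shiftSum_involution hσ hz hf hcen hsol, solution_comp_involution hσ hf hsol]
    ring
  have hg := sum_shiftSum_eq_zero hσ hz hf hcen hsol
  have h1 : ∑ i, c i * χ (z i) = β * α := by
    have : ∑ i, c i * χ (z i) = (∑ i, c i * shiftSum c z f (z i)) / α + β * α := by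
      rw [hα, mul_sum, sum_div, ← sum_add_distrib]
      exact sum_congr rfl fun i _ => by rw [hχ]; ring
    rw [this, hg, zero_div, zero_add]
  have h2 : ∑ i, c i * χ (σ (z i)) = -(β * α) := by
    have : ∑ i, c i * χ (σ (z i)) = (∑ i, c i * shiftSum c z f (z i)) / α - β * α := by
      rw [hα, mul_sum, sum_div, ← sum_sub_distrib]
      exact sum_congr rfl fun i _ => by rw [hχσ]; ring
    rw [this, hg, zero_div, zero_sub]
  refine ⟨χ, ?_, ?_, fun x => ?_⟩
  · rw [integral_diracCombination, h1]
    exact mul_ne_zero hβ0 hα0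
  · rw [integral_diracCombination, integral_diracCombination, h1, h2]
  · rw [integral_diracCombination, h2, hχ, hχσ]
    linear_combination f x * hβα

end Solution

section GivenBy

variable {χ : S →ₙ* ℂ}

theorem IsGivenBy.shiftSum_eq (hσ : IsInvolutiveMorphism σ)
    (h : IsGivenBy σ (diracCombination c z) f χ) (x : S) :
    shiftSum c z f x = -(∑ i, c i * χ (z i)) ^ 2 / 2 * (χ x + χ (σ x)) := by
  obtain ⟨-, h2, h3⟩ := h
  simp only [integral_diracCombination] at h2 h3
  have h : shiftSum c z f x = (∑ i, c i * χ (σ (z i))) / 2 *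
      (χ x * (∑ i, c i * χ (z i)) - χ (σ x) * ∑ i, c i * χ (σ (z i))) := by
    rw [shiftSum, mul_sum (a := χ x), mul_sum (a := χ (σ x)), ← sum_sub_distrib, mul_sum]
    refine sum_congr rfl fun i _ => ?_
    rw [h3, map_mul, hσ.comp_map_mul]
    ring
  rw [h, h2]
  ring

theorem IsGivenBy.isSolution (hσ : IsInvolutiveMorphism σ)
    (h : IsGivenBy σ (diracCombination c z) f χ) : IsSolution σ (diracCombination c z) f := by
  rw [isSolution_diracCombination_iff]
  intro x y
  rw [h.shiftSum_eq hσ, h.shiftSum_eq hσ]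
  obtain ⟨-, h2, h3⟩ := h
  simp only [integral_diracCombination] at h2 h3
  rw [h3, h3, h2, hσ.comp_map_mul, hσ.comp_map_mul, map_mul, map_mul, hσ.2]
  ring

theorem IsGivenBy.isCentralFunction {μ : @MeasureTheory.ComplexMeasure S ⊤}
    (hσ : IsInvolutiveMorphism σ) (h : IsGivenBy σ μ f χ) : IsCentralFunction f := by
  intro x y
  rw [h.2.2, h.2.2, map_mul, map_mul, hσ.comp_map_mul, hσ.comp_map_mul, mul_comm (χ x),
    mul_comm (χ (σ x))]

theorem IsGivenBy.ne_zero {μ : @MeasureTheory.ComplexMeasure S ⊤} (h : IsGivenBy σ μ f χ) :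
    f ≠ 0 := by
  rintro rfl
  obtain ⟨h1, h2, h3⟩ := h
  have hχ : (fun t => χ (σ t)) = fun t => χ t := by
    funext x
    have h4 := h3 x
    rw [h2, Pi.zero_apply, eq_comm, mul_eq_zero, neg_eq_zero, or_iff_left h1] at h4
    linear_combination -2 * h4
  rw [hχ] at h2
  exact h1 (self_eq_neg.1 h2)

theorem IsGivenBy.continuous_iff [TopologicalSpace S] [ContinuousMul S] (hcont : Continuous σ)
    (hσ : IsInvolutiveMorphism σ) (h : IsGivenBy σ (diracCombination c z) f χ) :
    Continuous f ↔ Continuous χ := by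
  constructor
  · intro hf
    have hE : Continuous (shiftSum c z f) :=
      continuous_finsetSum _ fun i _ =>
        continuous_const.mul (hf.comp (continuous_id.mul continuous_const))
    have hχ : ⇑χ = fun x => -((∑ i, c i * χ (z i)) * f x + shiftSum c z f x) /
        (∑ i, c i * χ (z i)) ^ 2 := by
      funext x
      rw [h.shiftSum_eq hσ]
      obtain ⟨h1, h2, h3⟩ := h
      simp only [integral_diracCombination] at h1 h2 h3
      rw [h3, h2]
      field_simp
      ring
    rw [hχ]
    exact ((continuous_const.mul hf).add hE).neg.div_const _
  · intro hχ
    rw [funext h.2.2]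
    exact ((hχ.sub (hχ.comp hcont)).div_const 2).mul continuous_const

end GivenBy

end VanVleck

theorem theorem4p3 {S : Type*} [Semigroup S] (σ : S → S)
    (hσ : VanVleck.IsInvolutiveMorphism σ)
    {ι : Type*} [Fintype ι] (c : ι → ℂ) (z : ι → S) (hz : ∀ i, z i ∈ Set.center S)
    (μ : @MeasureTheory.ComplexMeasure S ⊤) (hμ : μ = VanVleck.diracCombination c z) :
    (∀ f : S → ℂ,
      (f ≠ 0 ∧ VanVleck.IsCentralFunction f ∧ VanVleck.IsSolution σ μ f) ↔
        ∃ χ : S →ₙ* ℂ, VanVleck.IsGivenBy σ μ f χ) ∧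
    (∀ [TopologicalSpace S] [ContinuousMul S], Continuous σ →
      ∀ (f : S → ℂ) (χ : S →ₙ* ℂ), VanVleck.IsGivenBy σ μ f χ →
        (Continuous f ↔ Continuous χ)) := by
  subst hμ
  refine ⟨fun f => ⟨?_, ?_⟩, fun hcont f χ h => h.continuous_iff hcont hσ⟩
  · rintro ⟨hf, hcen, hsol⟩
    exact VanVleck.exists_isGivenBy hσ hz hf hcen
      (VanVleck.isSolution_diracCombination_iff.1 hsol)
  · rintro ⟨χ, h⟩
    exact ⟨h.ne_zero, h.isCentralFunction hσ, h.isSolution hσ⟩
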